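/- Let $V=\bigoplus_{k\ge 0}V_k$ be a vertex operator algebra over $\mathbb{C}$ of central charge $C$ with $\dim V_k<\infty$ and $V_0=\mathbb{C}\mathbf 1$, vertex operators $Y(a,z)=\sum_{n\in\mathbb{Z}}a_nz^{-n-1}$ and Virasoro modes $L_n$. Suppose that $V$ has a Li–Zamolodchikov metric, i.e. a non-degenerate symmetric bilinear form $\langle\,,\rangle$ with $\langle\mathbf 1,\mathbf 1\rangle=1$ and $$\langle Y(e^{zL_1}(-z^{-2})^{L_0}c,z^{-1})a,b\rangle=\langle a,Y(c,z)b\rangle\qquad(a,b,c\in V).$$ Suppose that $V_1=0$ and that the space $P_2=\{v\in V_2: L_nv=0 \text{ for all } n>0\}$ of weight two primary vectors has dimension $p_2=\dim P_2>0$. Let $\{u_\alpha\}$ and $\{u^\alpha\}$ be bases of $P_2$ with $\langle u^\alpha,u_\beta\rangle=\delta^\alpha_\beta$, and put $$\lambda^{(6)}=\sum_\alpha u^\alpha_{-3}u_\alpha\in V_6 .$$ Let $V_6(C,0)\subseteq V_6$ be the space of Virasoro descendants of the vacuum of weight $6$, i.e. the span of the vectors $L_{-m_1}\cdots L_{-m_k}\mathbf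 1$ with $m_i\ge 1$ and $m_1+\cdots+m_k=6$. If $C\notin\{0,-\tfrac{22}{5},-\tfrac{68}{7},\tfrac12\}$ and $\lambda^{(6)}\in V_6(C,0)$, then $C^2-55C+748\neq 0$ and $$p_2=\frac{1}{2}\,\frac{(5C+22)(2C-1)(7C+68)}{C^2-55C+748}.$$ -/

import Mathlib

/-- The mode `a_n` in `Y(a,z) = ∑ a_n z^{-n-1}`. -/
noncomputable def vertexMode {V : Type*} [AddCommGroup V] [Module ℂ V]
    (Y : V →ₗ[ℂ] VertexOperator ℂ V) (a : V) (n : ℤ) : Module.End ℂ V :=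
  VertexOperator.ncoeff (Y a) n

/-- A vertex operator algebra over `ℂ` with `V = ⨁_{k ≥ 0} V_k` and `V_0 = ℂ 𝟏`.
The modes of the conformal vector are `L_n = ω_{n+1}`. -/
structure VertexOperatorAlgebra (V : Type*) [AddCommGroup V] [Module ℂ V] where
  /-- The state-field map `a ↦ Y(a,z)`, with values in fields (lower truncated on each vector). -/
  Y : V →ₗ[ℂ] VertexOperator ℂ V
  /-- The vacuum vector. -/
  vac : V
  /-- The conformal vector. -/
  conf : V
  /-- The central charge. -/
  c : ℂ
  /-- The space of vectors of conformal weight `k`. -/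
  wt : ℕ → Submodule ℂ V
  wt_isInternal : DirectSum.IsInternal wt
  wt_finite : ∀ k, Module.Finite ℂ (wt k)
  vac_ne_zero : vac ≠ 0
  wt_zero : wt 0 = Submodule.span ℂ {vac}
  conf_mem : conf ∈ wt 2
  /-- `Y(𝟏,z) = id`. -/
  mode_vac : ∀ n : ℤ, vertexMode Y vac n = if n = -1 then 1 else 0
  /-- `Y(a,z)𝟏 ∈ a + z V[[z]]`. -/
  mode_neg_one_vac : ∀ a : V, vertexMode Y a (-1) vac = a
  mode_nonneg_vac : ∀ (a : V) (n : ℤ), 0 ≤ n → vertexMode Y a n vac = 0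
  /-- Mutual locality: `(z-w)^N [Y(a,z), Y(b,w)] = 0` for some `N`; this is the coefficient of
  `z^{-m-1} w^{-n-1}`. -/
  locality : ∀ a b : V, ∃ N : ℕ, ∀ m n : ℤ,
    ∑ i ∈ Finset.range (N + 1), ((-1 : ℂ) ^ i * (N.choose i : ℂ)) •
      ⁅vertexMode Y a (m + N - i), vertexMode Y b (n + i)⁆ = 0
  /-- The Virasoro algebra of central charge `c`. -/
  virasoro : ∀ m n : ℤ,
    ⁅vertexMode Y conf (m + 1), vertexMode Y conf (n + 1)⁆ =
      ((m - n : ℤ) : ℂ) • vertexMode Y conf (m + n + 1) +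
        (if m + n = 0 then ((m ^ 3 - m : ℤ) : ℂ) / 12 * c else 0) • (1 : Module.End ℂ V)
  /-- `L_0` gives the conformal weight grading. -/
  L_zero : ∀ (k : ℕ), ∀ a ∈ wt k, vertexMode Y conf 1 a = (k : ℂ) • a
  /-- `Y(L_{-1} a, z) = ∂_z Y(a,z)`. -/
  mode_L_neg_one : ∀ (a : V) (n : ℤ),
    vertexMode Y (vertexMode Y conf 0 a) n = (-n : ℂ) • vertexMode Y a (n - 1)
  /-- `[L_{-1}, Y(a,z)] = ∂_z Y(a,z)`. -/
  L_neg_one_comm : ∀ (a : V) (n : ℤ),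
    ⁅vertexMode Y conf 0, vertexMode Y a n⁆ = (-n : ℂ) • vertexMode Y a (n - 1)

namespace VertexOperatorAlgebra

variable {V : Type*} [AddCommGroup V] [Module ℂ V] (A : VertexOperatorAlgebra V)

/-- The mode `a_n`. -/
noncomputable def mode (a : V) (n : ℤ) : Module.End ℂ V := vertexMode A.Y a n

/-- The Virasoro mode `L_n = ω_{n+1}`. -/
noncomputable def L (n : ℤ) : Module.End ℂ V := A.mode A.conf (n + 1)

/-- `V_n(C,0)` inside `V`: the Virasoro descendants of the vacuum of weight `n`, spanned by the
`L_{-m₁} ⋯ L_{-m_k} 𝟏` with all `m_i ≥ 1` and `m₁ + ⋯ + m_k = n`. -/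
noncomputable def vacuumDescendants (n : ℕ) : Submodule ℂ V :=
  Submodule.span ℂ {v | ∃ l : List ℕ, (∀ m ∈ l, 1 ≤ m) ∧ l.sum = n ∧
    v = l.foldr (fun m w => A.L (-(m : ℤ)) w) A.vac}

/-- `P_k`: the primary vectors of weight `k`. -/
noncomputable def primary (k : ℕ) : Submodule ℂ V :=
  A.wt k ⊓ ⨅ n : {n : ℤ // 0 < n}, LinearMap.ker (A.L n)

/-- `B` is a Li-Zamolodchikov metric: a symmetric invertible bilinear form with `⟨𝟏,𝟏⟩ = 1` and
`⟨Y(e^{z L_1} (-z^{-2})^{L_0} x, z^{-1}) a, b⟩ = ⟨a, Y(x,z) b⟩`.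
For `x` of weight `k` the sum in `invariant` is the coefficient of `z^{-m-1}` on the left
(the terms with `i > k` vanish as `L_1^i x = 0`). -/
structure IsLiZMetric (B : LinearMap.BilinForm ℂ V) : Prop where
  symm : B.IsSymm
  nondegenerate : B.Nondegenerate
  vac_vac : B A.vac A.vac = 1
  invariant : ∀ (k : ℕ), ∀ x ∈ A.wt k, ∀ (m : ℤ) (a b : V),
    ∑ i ∈ Finset.range (k + 1), ((-1 : ℂ) ^ k / (i.factorial : ℂ)) *
      B (A.mode ((A.L 1 ^ i) x) (2 * k - i - m - 2) a) b = B a (A.mode x m b)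

/-- The quadratic Casimir vector `λ^{(n)} = ∑_α u^α_{3-n} u_α` of families `u_α`, `u^α` of
weight two primary vectors. -/
noncomputable def casimir {ι : Type*} [Fintype ι] (u u' : ι → A.primary 2) (n : ℤ) : V :=
  ∑ α, A.mode (u' α : V) (3 - n) (u α : V)

end VertexOperatorAlgebra

/-! The Casimir vectors satisfy `L_m λ^(n) = (m+n-2) λ^(n-m)` and `λ^(0) = p₂ 𝟏`. So if `λ^(6)` is a
combination of the four spanning Virasoro descendants of weight 6, applying `L_2` and `L_3`
expresses `λ^(4)`, `λ^(2)` and `λ^(3)` through the same four coefficients. The scalars `L_m λ^(m) =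
(2m-2) p₂ 𝟏`, for `m = 2, 3, 4, 6`, then give linear equations for these coefficients in terms of
`p₂` (`L_casimir`, `casimir_zero`). One more equation comes from outside the Virasoro algebra. For
`b` in `P_2`, the commutator formula and the symmetry of the Casimir tensor give `b_5 λ^(6) - 3 b_3
λ^(4) + 2 b_1 λ^(2) = 4b` (`mode_casimir`). Pairing it with a dual primary vector evaluates the left
side on Virasoro descendants, because the adjoints of the `L_{-m}` kill primaries. The equations are
then overdetermined and fix `p₂` (`eq_of_casimir_system`). The axioms provide locality only, so the
commutator formula `mode_bracket_mode` is first derived through Dong's lemma and Goddard's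
uniqueness theorem. -/

/-! ### Multiplication by differences of formal variables, as difference operators on coefficients.
-/

section Shift

variable {Λ E : Type*} [AddCommGroup Λ] [AddCommGroup E] [Module ℂ E]

/-- Translation by `v` on functions on an abelian group. -/
def shiftOp (v : Λ) : Module.End ℂ (Λ → E) := LinearMap.funLeft ℂ E (fun p => p + v)

/-- The difference of the translations by `v` and by `w`. -/
def diffOp (v w : Λ) : Module.End ℂ (Λ → E) := shiftOp v - shiftOp w

@[simp] lemma shiftOp_apply (v : Λ) (G : Λ → E) (p : Λ) : shiftOp v G p = G (p + v) := rfl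

lemma diffOp_apply (v w : Λ) (G : Λ → E) (p : Λ) : diffOp v w G p = G (p + v) - G (p + w) := rfl

lemma shiftOp_commute (v w : Λ) : Commute (shiftOp v : Module.End ℂ (Λ → E)) (shiftOp w) := by
  refine LinearMap.ext fun G => funext fun p => ?_
  simp [Module.End.mul_apply, add_right_comm]

lemma diffOp_commute (v w v' w' : Λ) :
    Commute (diffOp v w : Module.End ℂ (Λ → E)) (diffOp v' w') :=
  ((shiftOp_commute v v').sub_left (shiftOp_commute w v')).sub_right
    ((shiftOp_commute v w').sub_left (shiftOp_commute w w'))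

lemma shiftOp_pow_apply (v : Λ) (k : ℕ) (G : Λ → E) (p : Λ) :
    (shiftOp v ^ k) G p = G (p + k • v) := by
  induction k generalizing p with
  | zero => simp
  | succ k ih => rw [pow_succ', Module.End.mul_apply, shiftOp_apply, ih, succ_nsmul']; congr 1; abel

lemma diffOp_pow_apply (v w : Λ) (N : ℕ) (G : Λ → E) (p : Λ) :
    (diffOp v w ^ N) G p = ∑ i ∈ Finset.range (N + 1),
      ((-1 : ℂ) ^ i * (N.choose i : ℂ)) • G (p + (N - i) • v + i • w) := by
  have h : (diffOp v w : Module.End ℂ (Λ → E)) = -shiftOp w + shiftOp v := by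
    rw [diffOp]; abel
  have hc : Commute (-shiftOp w : Module.End ℂ (Λ → E)) (shiftOp v) :=
    Commute.neg_left (show Commute (shiftOp w : Module.End ℂ (Λ → E)) _ from shiftOp_commute w v)
  rw [h, hc.add_pow, LinearMap.sum_apply, Finset.sum_apply]
  refine Finset.sum_congr rfl fun i _ => ?_
  have e : (-shiftOp w) ^ i * shiftOp v ^ (N - i) * ((N.choose i : ℕ) : Module.End ℂ (Λ → E)) =
      ((-1 : ℂ) ^ i * (N.choose i : ℂ)) • (shiftOp w ^ i * shiftOp v ^ (N - i)) := by
    rw [← nsmul_eq_mul', mul_smul, Nat.cast_smul_eq_nsmul, ← neg_one_smul ℂ (shiftOp w), smul_pow,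
      smul_mul_assoc, smul_comm]
  rw [e, LinearMap.smul_apply, Pi.smul_apply, Module.End.mul_apply, shiftOp_pow_apply,
    shiftOp_pow_apply]
  congr 2
  abel

/-- If `z₁ - z₂` and `z₁ - w` act nilpotently on `G`, then so does `z₂ - w`. -/
lemma diffOp_pow_eq_zero (v₁ v₂ v₃ : Λ) (G : Λ → E) (N : ℕ)
    (h12 : (diffOp v₁ v₂ ^ N) G = 0) (h13 : (diffOp v₁ v₃ ^ N) G = 0) :
    (diffOp v₂ v₃ ^ (2 * N)) G = 0 := by
  have h : (diffOp v₂ v₃ : Module.End ℂ (Λ → E)) = diffOp v₁ v₃ + -diffOp v₁ v₂ := by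
    simp only [diffOp]; abel
  have hc : Commute (diffOp v₁ v₃ : Module.End ℂ (Λ → E)) (-diffOp v₁ v₂) :=
    Commute.neg_right
      (show Commute (diffOp v₁ v₃ : Module.End ℂ (Λ → E)) _ from diffOp_commute v₁ v₃ v₁ v₂)
  -- In the expansion of `((z₁ - w) - (z₁ - z₂))^(2N)` every term contains one of the two factors to
  -- a power at least `N`.
  rw [h, hc.add_pow, LinearMap.sum_apply]
  refine Finset.sum_eq_zero fun i _ => ?_
  rw [← nsmul_eq_mul', LinearMap.smul_apply]
  suffices h : (diffOp v₁ v₃ ^ i * (-diffOp v₁ v₂) ^ (2 * N - i) : Module.End ℂ (Λ → E)) G = 0 by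
    rw [h, smul_zero]
  rcases le_or_gt N i with hi | hi
  · rw [(hc.pow_pow i _).eq, Module.End.mul_apply, ← Nat.sub_add_cancel hi, pow_add,
      Module.End.mul_apply, h13, map_zero, map_zero]
  · rw [← neg_one_smul ℂ (diffOp v₁ v₂), smul_pow, Module.End.mul_apply, LinearMap.smul_apply,
      show 2 * N - i = (N - i) + N by omega, pow_add (diffOp v₁ v₂), Module.End.mul_apply, h12]
    simp

end Shift

/-! ### Distributions supported on the diagonal `z = w`. -/

section TwoVariables

variable {E : Type*} [AddCommGroup E] [Module ℂ E]

/-- Multiplication by `z - w` on the coefficient functions of formal distributions in `z`, `w`. -/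
abbrev diffTwo : Module.End ℂ (ℤ × ℤ → E) := diffOp (1, 0) (0, 1)

lemma diffTwo_apply (G : ℤ × ℤ → E) (m n : ℤ) :
    diffTwo G (m, n) = G (m + 1, n) - G (m, n + 1) := by
  simp [diffOp_apply]

lemma diffTwo_pow_apply (N : ℕ) (G : ℤ × ℤ → E) (m n : ℤ) :
    (diffTwo ^ N) G (m, n) = ∑ i ∈ Finset.range (N + 1),
      ((-1 : ℂ) ^ i * (N.choose i : ℂ)) • G (m + N - i, n + i) := by
  rw [diffOp_pow_apply]
  refine Finset.sum_congr rfl fun i hi => ?_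
  have := Finset.mem_range_succ_iff.mp hi
  congr 2
  ext <;> simp [Nat.cast_sub this, add_sub_assoc]

/-- Newton expansion of a distribution annihilated by `(z - w)^N`. -/
lemma eq_sum_choose_of_diffTwo_pow_eq_zero (N : ℕ) (G : ℤ × ℤ → E) (h : (diffTwo ^ N) G = 0)
    (m n : ℤ) :
    G (m, n) = ∑ j ∈ Finset.range N, Ring.choose m j • (diffTwo ^ j) G (0, m + n - j) := by
  induction N generalizing G m n with
  | zero => simpa using congrFun h (m, n)
  | succ N ih =>
    have hD := ih (diffTwo G) (by rw [← Module.End.mul_apply, ← pow_succ, h])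
    -- `R` has the same differences as `G` and the same values at `m = 0`, so the two agree by
    -- moving along each line `m + n = const` in both directions.
    set R : ℤ → ℤ → E := fun m n =>
      ∑ j ∈ Finset.range (N + 1), Ring.choose m j • (diffTwo ^ j) G (0, m + n - j) with hR
    have hstep : ∀ m n, R (m + 1) n - R m (n + 1) = G (m + 1, n) - G (m, n + 1) := by
      intro m n
      rw [← diffTwo_apply, hD m n]
      simp only [hR]
      rw [← Finset.sum_sub_distrib, Finset.sum_range_succ']
      have e0 : m + 1 + n = m + (n + 1) := by ring
      simp only [e0, Ring.choose_zero_right, sub_self, add_zero]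
      refine Finset.sum_congr rfl fun j _ => ?_
      rw [Ring.choose_succ_succ, add_smul, add_sub_cancel_right, pow_succ, Module.End.mul_apply]
      rw [show m + (n + 1) - ((j + 1 : ℕ) : ℤ) = m + n - j by push_cast; ring]
    have h0 : ∀ n, G (0, n) = R 0 n := by
      intro n
      simp only [hR]
      rw [Finset.sum_range_succ']
      simp [Ring.choose_zero_succ]
    change G (m, n) = R m n
    induction m using Int.induction_on generalizing n with
    | zero => exact h0 n
    | succ i ihi =>
      have := hstep i n
      rw [ihi (n + 1)] at this
      exact (sub_left_injective this).symm
    | pred i ihi =>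
      have := hstep (-i - 1) (n - 1)
      rw [sub_add_cancel, sub_add_cancel, ihi (n - 1)] at this
      exact (sub_right_injective this).symm

end TwoVariables

/-! ### From locality to the commutator formula. -/

namespace VertexOperatorAlgebra

variable {V : Type*} [AddCommGroup V] [Module ℂ V] (A : VertexOperatorAlgebra V)

attribute [local instance] LieRing.ofAssociativeRing LieAlgebra.ofAssociativeAlgebra

lemma mode_add (a b : V) (n : ℤ) : A.mode (a + b) n = A.mode a n + A.mode b n := by
  simp [mode, vertexMode]

lemma mode_smul (r : ℂ) (a : V) (n : ℤ) : A.mode (r • a) n = r • A.mode a n := by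
  simp [mode, vertexMode]

/-- The mode `a_n` as a linear function of `a`. -/
noncomputable def modeₗ (n : ℤ) : V →ₗ[ℂ] Module.End ℂ V where
  toFun a := A.mode a n
  map_add' a b := A.mode_add a b n
  map_smul' r a := A.mode_smul r a n

@[simp] lemma mode_zero (n : ℤ) : A.mode 0 n = 0 := (A.modeₗ n).map_zero

/-- The coefficients of the commutator `[Y(a,z), Y(b,w)]`. -/
noncomputable def modeBracket (a b : V) (p : ℤ × ℤ) : Module.End ℂ V :=
  ⁅A.mode a p.1, A.mode b p.2⁆

lemma exists_diffTwo_pow_modeBracket (a b : V) :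
    ∃ N : ℕ, (diffTwo ^ N) (A.modeBracket a b) = 0 := by
  obtain ⟨N, hN⟩ := A.locality a b
  refine ⟨N, funext fun ⟨m, n⟩ => ?_⟩
  rw [diffTwo_pow_apply]
  exact hN m n

lemma pow_apply_eq_zero_of_le {E : Type*} [AddCommGroup E] [Module ℂ E] {f : Module.End ℂ E}
    {x : E} {N M : ℕ} (h : (f ^ N) x = 0) (hM : N ≤ M) : (f ^ M) x = 0 := by
  rw [← Nat.sub_add_cancel hM, pow_add, Module.End.mul_apply, h, map_zero]

/-- The modes of the `j`-th product of the fields `Y(a,z)` and `Y(b,z)`, for `0 ≤ j`. -/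
noncomputable def fieldProduct (a b : V) (j : ℕ) (n : ℤ) : Module.End ℂ V :=
  (diffTwo ^ j) (A.modeBracket a b) (0, n)

/-- Bracketing with `L_{-1}` acts as `∂_z + ∂_w`, which commutes with multiplication by `z - w`. -/
lemma L_neg_one_bracket_diffTwo (a b : V) (j : ℕ) (m n : ℤ) :
    ⁅A.mode A.conf 0, (diffTwo ^ j) (A.modeBracket a b) (m, n)⁆ =
      (-m : ℂ) • (diffTwo ^ j) (A.modeBracket a b) (m - 1, n) +
        (-n : ℂ) • (diffTwo ^ j) (A.modeBracket a b) (m, n - 1) := by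
  induction j generalizing m n with
  | zero =>
    have h1 : ⁅A.mode A.conf 0, A.mode a m⁆ = (-m : ℂ) • A.mode a (m - 1) := A.L_neg_one_comm a m
    have h2 : ⁅A.mode A.conf 0, A.mode b n⁆ = (-n : ℂ) • A.mode b (n - 1) := A.L_neg_one_comm b n
    simp only [pow_zero, Module.End.one_apply, modeBracket]
    rw [leibniz_lie, h1, h2, smul_lie, lie_smul]
  | succ j ih =>
    simp only [pow_succ', Module.End.mul_apply, diffTwo_apply, lie_sub, ih]
    simp only [add_sub_cancel_right, sub_add_cancel, Int.cast_add, Int.cast_one]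
    module

/-- For `n ≥ -1` only the term `a_j b_n 𝟏` can survive. Since `L_{-1} 𝟏 = 0`, both sides obey
`L_{-1} f_n 𝟏 = -n f_{n-1} 𝟏`, which determines all lower modes because `n ≠ 0` there. -/
lemma fieldProduct_vac (a b : V) (j : ℕ) (n : ℤ) :
    A.fieldProduct a b j n A.vac = A.mode (A.mode a j b) n A.vac := by
  have hnn : ∀ (x : V) (k : ℤ), 0 ≤ k → A.mode x k A.vac = 0 := A.mode_nonneg_vac
  have hn1 : ∀ x : V, A.mode x (-1) A.vac = x := A.mode_neg_one_vac
  have key : ∀ k : ℤ, -1 ≤ k →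
      A.fieldProduct a b j k A.vac = A.mode (A.mode a j b) k A.vac := by
    intro k hk
    rw [fieldProduct, diffTwo_pow_apply, LinearMap.sum_apply, Finset.sum_range_succ']
    rw [Finset.sum_eq_zero]
    · simp only [modeBracket, Ring.lie_def, LinearMap.smul_apply, LinearMap.sub_apply,
        Module.End.mul_apply]
      rw [hnn a _ (by simp)]
      rcases hk.eq_or_lt with rfl | hk
      · simp [hn1]
      · rw [hnn _ k (by omega), hnn _ _ (by simp; omega)]
        simp
    · intro i hi
      have := Finset.mem_range.mp hi
      simp only [modeBracket, Ring.lie_def, LinearMap.smul_apply, LinearMap.sub_apply,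
        Module.End.mul_apply]
      rw [hnn a _ (by push_cast; omega), hnn b _ (by push_cast; omega)]
      simp
  have down : ∀ k : ℕ,
      A.fieldProduct a b j (-1 - k) A.vac = A.mode (A.mode a j b) (-1 - k) A.vac := by
    intro k
    induction k with
    | zero => exact key _ (by simp)
    | succ k ih =>
      have e1 := A.L_neg_one_bracket_diffTwo a b j 0 (-1 - k)
      have e2 : ⁅A.mode A.conf 0, A.mode (A.mode a j b) (-1 - k)⁆ = _ :=
        A.L_neg_one_comm (A.mode a j b) (-1 - k)
      replace e1 := congrArg (fun f => f A.vac) e1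
      replace e2 := congrArg (fun f => f A.vac) e2
      simp only [Ring.lie_def, LinearMap.sub_apply, Module.End.mul_apply,
        LinearMap.smul_apply, hnn A.conf 0 le_rfl, map_zero, sub_zero, Int.cast_zero, neg_zero,
        zero_smul, zero_add] at e1 e2
      change A.mode A.conf 0 (A.fieldProduct a b j (-1 - k) A.vac) =
        _ • A.fieldProduct a b j (-1 - k - 1) A.vac at e1
      rw [ih, e2] at e1
      have hne : (-((-1 - k : ℤ) : ℂ)) ≠ 0 := by
        rw [neg_ne_zero, Int.cast_ne_zero]; omega
      have := smul_right_injective V hne e1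
      rw [show (-1 - ((k + 1 : ℕ) : ℤ)) = -1 - k - 1 by push_cast; ring]
      exact this.symm
  rcases le_or_gt (-1) n with h | h
  · exact key n h
  · have := down (-1 - n).toNat
    rwa [show (-1 - ((-1 - n).toNat : ℤ)) = n by omega] at this

/-- **Dong's lemma**. -/
lemma exists_diffTwo_pow_fieldProduct (a b d : V) (j : ℕ) : ∃ M : ℕ,
    (diffTwo ^ M) (fun p : ℤ × ℤ => ⁅A.fieldProduct a b j p.1, A.mode d p.2⁆) = 0 := by
  obtain ⟨N₁, h₁⟩ := A.exists_diffTwo_pow_modeBracket a b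
  obtain ⟨N₂, h₂⟩ := A.exists_diffTwo_pow_modeBracket b d
  obtain ⟨N₃, h₃⟩ := A.exists_diffTwo_pow_modeBracket a d
  set N := N₁ + N₂ + N₃ with hN
  replace h₁ := pow_apply_eq_zero_of_le h₁ (show N₁ ≤ N by omega)
  replace h₂ := pow_apply_eq_zero_of_le h₂ (show N₂ ≤ N by omega)
  replace h₃ := pow_apply_eq_zero_of_le h₃ (show N₃ ≤ N by omega)
  let e₁ : ℤ × ℤ × ℤ := (1, 0, 0)
  let e₂ : ℤ × ℤ × ℤ := (0, 1, 0)
  let e₃ : ℤ × ℤ × ℤ := (0, 0, 1)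
  let F : ℤ × ℤ × ℤ → Module.End ℂ V := fun p => ⁅⁅A.mode a p.1, A.mode b p.2.1⁆, A.mode d p.2.2⁆
  let F₁ : ℤ × ℤ × ℤ → Module.End ℂ V := fun p => ⁅A.mode a p.1, ⁅A.mode b p.2.1, A.mode d p.2.2⁆⁆
  let F₂ : ℤ × ℤ × ℤ → Module.End ℂ V := fun p => ⁅A.mode b p.2.1, ⁅A.mode a p.1, A.mode d p.2.2⁆⁆
  have hF : F = F₁ - F₂ := by
    funext p
    simp only [F, F₁, F₂, Pi.sub_apply]
    rw [lie_lie]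
  have k12 : ∀ (k : ℕ) (m n q : ℤ), (diffOp e₁ e₂ ^ k) F (m, n, q) =
      ⁅(diffTwo ^ k) (A.modeBracket a b) (m, n), A.mode d q⁆ := by
    intro k
    induction k with
    | zero => intro m n q; rfl
    | succ k ih =>
      intro m n q
      simp only [pow_succ', Module.End.mul_apply, diffOp_apply, sub_lie, ← ih]
      simp [e₁, e₂]
  have k23 : ∀ (k : ℕ) (m n q : ℤ), (diffOp e₂ e₃ ^ k) F₁ (m, n, q) =
      ⁅A.mode a m, (diffTwo ^ k) (A.modeBracket b d) (n, q)⁆ := by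
    intro k
    induction k with
    | zero => intro m n q; rfl
    | succ k ih =>
      intro m n q
      simp only [pow_succ', Module.End.mul_apply, diffOp_apply, lie_sub, ← ih]
      simp [e₂, e₃]
  have k13 : ∀ (k : ℕ) (m n q : ℤ), (diffOp e₁ e₃ ^ k) F₂ (m, n, q) =
      ⁅A.mode b n, (diffTwo ^ k) (A.modeBracket a d) (m, q)⁆ := by
    intro k
    induction k with
    | zero => intro m n q; rfl
    | succ k ih =>
      intro m n q
      simp only [pow_succ', Module.End.mul_apply, diffOp_apply, lie_sub, ← ih]
      simp [e₁, e₃]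
  have z12 : (diffOp e₁ e₂ ^ N) F = 0 := by
    funext ⟨m, n, q⟩; rw [k12, h₁]; simp
  have z23 : (diffOp e₂ e₃ ^ N) F₁ = 0 := by
    funext ⟨m, n, q⟩; rw [k23, h₂]; simp
  have z13 : (diffOp e₁ e₃ ^ N) F₂ = 0 := by
    funext ⟨m, n, q⟩; rw [k13, h₃]; simp
  have hc : ∀ v w v' w' : ℤ × ℤ × ℤ, ∀ k l : ℕ, ∀ G : ℤ × ℤ × ℤ → Module.End ℂ V,
      (diffOp v w ^ k) ((diffOp v' w' ^ l) G) = (diffOp v' w' ^ l) ((diffOp v w ^ k) G) := by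
    intro v w v' w' k l G
    rw [← Module.End.mul_apply, ((diffOp_commute v w v' w').pow_pow k l).eq, Module.End.mul_apply]
  -- The factor `(z₂ - w)^N` removes `F₁`, leaving `-F₂`, on which `z₁ - w` is nilpotent; `z₁ - z₂`
  -- is nilpotent on `F` itself.
  have zF : (diffOp e₂ e₃ ^ (2 * N)) ((diffOp e₂ e₃ ^ N) F) = 0 := by
    refine diffOp_pow_eq_zero e₁ e₂ e₃ _ N ?_ ?_
    · rw [hc, z12, map_zero]
    · rw [hF, map_sub, z23, zero_sub, map_neg, hc, z13, map_zero, neg_zero]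
  have zj : (diffOp e₂ e₃ ^ (2 * N + N)) ((diffOp e₁ e₂ ^ j) F) = 0 := by
    rw [hc, pow_add, Module.End.mul_apply, zF, map_zero]
  refine ⟨2 * N + N, funext fun ⟨n, q⟩ => ?_⟩
  have kk : ∀ (k : ℕ) (n q : ℤ), (diffOp e₂ e₃ ^ k) ((diffOp e₁ e₂ ^ j) F) (0, n, q) =
      (diffTwo ^ k) (fun p : ℤ × ℤ => ⁅A.fieldProduct a b j p.1, A.mode d p.2⁆) (n, q) := by
    intro k
    induction k with
    | zero => intro n q; simp only [pow_zero, Module.End.one_apply]; exact k12 j 0 n q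
    | succ k ih =>
      intro n q
      simp only [pow_succ' _ k, Module.End.mul_apply, diffOp_apply]
      simp [e₂, e₃, ← ih]
  rw [← kk, zj]
  rfl

/-- The uniqueness theorem of Goddard, for the products of two fields. -/
lemma fieldProduct_eq_mode (a b : V) (j : ℕ) (n : ℤ) :
    A.fieldProduct a b j n = A.mode (A.mode a j b) n := by
  have hnn : ∀ (x : V) (k : ℤ), 0 ≤ k → A.mode x k A.vac = 0 := A.mode_nonneg_vac
  refine LinearMap.ext fun d => ?_
  obtain ⟨M₁, h₁⟩ := A.exists_diffTwo_pow_fieldProduct a b d j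
  obtain ⟨M₂, h₂⟩ := A.exists_diffTwo_pow_modeBracket (A.mode a j b) d
  replace h₁ := pow_apply_eq_zero_of_le h₁ (show M₁ ≤ M₁ + M₂ by omega)
  replace h₂ := pow_apply_eq_zero_of_le h₂ (show M₂ ≤ M₁ + M₂ by omega)
  set M := M₁ + M₂
  -- At this coefficient the `i`-th term contains `d_{i-1} 𝟏`, which is `d` for `i = 0` and zero
  -- otherwise. The terms in the opposite order agree for the two fields by `fieldProduct_vac`, so
  -- comparing both relations compares the `n`-th modes on `d`.
  replace h₁ := congrArg (fun f => f A.vac) (congrFun h₁ (n - M, -1))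
  replace h₂ := congrArg (fun f => f A.vac) (congrFun h₂ (n - M, -1))
  simp only [diffTwo_pow_apply, LinearMap.sum_apply, modeBracket, Ring.lie_def,
    LinearMap.smul_apply, LinearMap.sub_apply, Module.End.mul_apply, Pi.zero_apply,
    LinearMap.zero_apply, fieldProduct_vac] at h₁ h₂
  have := h₁.trans h₂.symm
  simp only [smul_sub, Finset.sum_sub_distrib, sub_left_inj] at this
  rw [Finset.sum_range_succ', Finset.sum_range_succ', Finset.sum_eq_zero, Finset.sum_eq_zero]
    at this
  · have hd : A.mode d (-1) A.vac = d := A.mode_neg_one_vac d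
    simpa [hd] using this
  · intro i _
    rw [hnn d _ (by push_cast; omega), map_zero, smul_zero]
  · intro i _
    rw [hnn d _ (by push_cast; omega), map_zero, smul_zero]

/-- The commutator formula. -/
theorem mode_bracket_mode (a b : V) (M : ℕ) (hM : ∀ j : ℕ, M ≤ j → A.mode a j b = 0) (m n : ℤ) :
    ⁅A.mode a m, A.mode b n⁆ =
      ∑ j ∈ Finset.range M, Ring.choose m j • A.mode (A.mode a j b) (m + n - j) := by
  obtain ⟨N, hN⟩ := A.exists_diffTwo_pow_modeBracket a b
  replace hN := pow_apply_eq_zero_of_le hN (show N ≤ N + M by omega)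
  have h := eq_sum_choose_of_diffTwo_pow_eq_zero _ _ hN m n
  change ⁅A.mode a m, A.mode b n⁆ = _ at h
  rw [h, ← Finset.sum_subset (Finset.range_mono (show M ≤ N + M by omega))]
  · exact Finset.sum_congr rfl fun j _ => by rw [← fieldProduct_eq_mode, fieldProduct]
  · intro j _ hj
    rw [← fieldProduct, fieldProduct_eq_mode, hM j (by simpa using hj)]
    simp

end VertexOperatorAlgebra

/-! ### Consequences of the commutator formula: weights, Virasoro action, adjoints, products on
`V_2`. -/

namespace VertexOperatorAlgebra

variable {V : Type*} [AddCommGroup V] [Module ℂ V] (A : VertexOperatorAlgebra V)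

attribute [local instance] LieRing.ofAssociativeRing LieAlgebra.ofAssociativeAlgebra

/-! ### The grading -/

lemma exists_mode_eq_zero (a b : V) : ∃ M : ℕ, ∀ j : ℕ, M ≤ j → A.mode a j b = 0 := by
  set o := HahnSeries.order ((HahnModule.of ℂ).symm (A.Y a b)) with ho
  refine ⟨(-o).toNat, fun j hj => ?_⟩
  exact VertexOperator.ncoeff_eq_zero_of_lt_order (A.Y a) j b (by rw [← ho]; omega)

/-- Eigenvectors of `L_0` are homogeneous. -/
lemma exists_decomposition_of_L_zero {v : V} {μ : ℂ} (hv : A.L 0 v = μ • v) :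
    ∃ x : DirectSum ℕ fun k => A.wt k, DirectSum.coeLinearMap A.wt x = v ∧
      ∀ k : ℕ, (k : ℂ) ≠ μ → x k = 0 := by
  obtain ⟨x, rfl⟩ := A.wt_isInternal.surjective v
  change A.L 0 (DirectSum.coeLinearMap A.wt x) = μ • DirectSum.coeLinearMap A.wt x at hv
  refine ⟨x, rfl, fun k hk => ?_⟩
  let T : (DirectSum ℕ fun k => A.wt k) →ₗ[ℂ] DirectSum ℕ fun k => A.wt k :=
    DirectSum.lmap fun k => ((k : ℂ) - μ) • LinearMap.id
  have hT : DirectSum.coeLinearMap A.wt ∘ₗ T =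
      (A.L 0 - μ • LinearMap.id) ∘ₗ DirectSum.coeLinearMap A.wt := by
    refine DirectSum.linearMap_ext ℂ fun i => LinearMap.ext fun y => ?_
    have hy : A.L 0 (y : V) = (i : ℂ) • (y : V) := A.L_zero i y y.2
    simp [T, hy, sub_smul]
  have h0 : DirectSum.coeLinearMap A.wt (T x) = 0 := by
    have := congrArg (fun f => f x) hT
    simp only [LinearMap.comp_apply, LinearMap.sub_apply, LinearMap.smul_apply,
      LinearMap.id_apply, hv, sub_self] at this
    exact this
  have hx : T x = 0 := A.wt_isInternal.injective (h0.trans (map_zero _).symm)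
  have : ((k : ℂ) - μ) • x k = 0 := by
    have := congrArg (fun f => f k) hx
    simpa [T, DirectSum.lmap_apply] using this
  exact (smul_eq_zero.mp this).resolve_left (sub_ne_zero.mpr hk)

lemma mem_wt_of_L_zero {v : V} {k : ℕ} (hv : A.L 0 v = (k : ℂ) • v) : v ∈ A.wt k := by
  obtain ⟨x, rfl, hx⟩ := A.exists_decomposition_of_L_zero hv
  have : x = DirectSum.lof ℂ ℕ (fun k => A.wt k) k (x k) := by
    refine DFinsupp.ext fun i => ?_
    rcases eq_or_ne k i with rfl | h
    · exact (DirectSum.lof_apply (M := fun k => A.wt k) ℂ k (x k)).symm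
    · rw [hx i (by exact_mod_cast h.symm)]
      exact (DirectSum.of_eq_of_ne (β := fun k => A.wt k) k i (x k) h.symm).symm
  rw [this, DirectSum.coeLinearMap_lof]
  exact (x k).2

lemma eq_zero_of_L_zero {v : V} {μ : ℂ} (hv : A.L 0 v = μ • v) (hμ : ∀ k : ℕ, (k : ℂ) ≠ μ) :
    v = 0 := by
  obtain ⟨x, rfl, hx⟩ := A.exists_decomposition_of_L_zero hv
  rw [show x = 0 from DFinsupp.ext fun i => hx i (hμ i), map_zero]

/-- In `[ω_1, a_n]` only the products `ω_0 a = L_{-1} a` and `ω_1 a = L_0 a` contribute, as `choose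
1 j = 0` for `j ≥ 2`. All weight counting for modes rests on this. -/
lemma L_zero_mode {k l : ℕ} {a b : V} (ha : a ∈ A.wt k) (hb : b ∈ A.wt l) (n : ℤ) :
    A.L 0 (A.mode a n b) = ((k + l - n - 1 : ℤ) : ℂ) • A.mode a n b := by
  obtain ⟨M, hM⟩ := A.exists_mode_eq_zero A.conf a
  have h := A.mode_bracket_mode A.conf a (M + 2) (fun j hj => hM j (by omega)) 1 n
  rw [Finset.sum_range_succ', Finset.sum_range_succ', Finset.sum_eq_zero] at h
  · have h0 : A.mode (A.mode A.conf 0 a) (1 + n) = (-(1 + n : ℤ) : ℂ) • A.mode a (1 + n - 1) :=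
      A.mode_L_neg_one a (1 + n)
    have h1 : A.mode A.conf 1 a = (k : ℂ) • a := A.L_zero k a ha
    have h2 : A.mode A.conf 1 b = (l : ℂ) • b := A.L_zero l b hb
    simp only [Nat.cast_zero, zero_add, Nat.cast_one, Ring.choose_one_right, one_smul,
      Ring.choose_zero_right, sub_zero, h0, h1, mode_smul, add_sub_cancel_left] at h
    replace h := congrArg (fun f => f b) h
    simp only [Ring.lie_def, LinearMap.sub_apply, Module.End.mul_apply, LinearMap.add_apply,
      LinearMap.smul_apply, h2, map_smul] at h
    change A.mode A.conf 1 (A.mode a n b) = _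
    rw [sub_eq_iff_eq_add.mp h]
    push_cast
    module
  · intro i _
    have : Ring.choose (1 : ℤ) (i + 1 + 1) = 0 := by
      rw [← Nat.cast_one, Ring.choose_natCast, Nat.choose_eq_zero_of_lt (by omega), Nat.cast_zero]
    rw [this, zero_smul]

lemma mode_mem_wt {k l r : ℕ} {a b : V} (ha : a ∈ A.wt k) (hb : b ∈ A.wt l) {n : ℤ}
    (h : (r : ℤ) = k + l - n - 1) : A.mode a n b ∈ A.wt r := by
  apply A.mem_wt_of_L_zero
  rw [A.L_zero_mode ha hb, ← h, Int.cast_natCast]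

lemma mode_eq_zero {k l : ℕ} {a b : V} (ha : a ∈ A.wt k) (hb : b ∈ A.wt l) {n : ℤ}
    (h : (k + l - n - 1 : ℤ) < 0) : A.mode a n b = 0 := by
  refine A.eq_zero_of_L_zero (A.L_zero_mode ha hb n) fun r hr => ?_
  have : (r : ℤ) = k + l - n - 1 := by exact_mod_cast hr
  omega

/-! ### The Virasoro algebra -/

lemma L_L_apply (m n : ℤ) (v : V) : A.L m (A.L n v) = A.L n (A.L m v) +
    ((m - n : ℤ) : ℂ) • A.L (m + n) v +
      (if m + n = 0 then ((m ^ 3 - m : ℤ) : ℂ) / 12 * A.c else 0) • v := by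
  have h := congrArg (fun f => f v) (A.virasoro m n)
  simp only [Ring.lie_def, LinearMap.sub_apply, Module.End.mul_apply, LinearMap.add_apply,
    LinearMap.smul_apply, Module.End.one_apply] at h
  rw [add_assoc, ← sub_eq_iff_eq_add']
  exact h

lemma L_vac {m : ℤ} (hm : -1 ≤ m) : A.L m A.vac = 0 :=
  A.mode_nonneg_vac A.conf (m + 1) (by omega)

lemma vac_mem : A.vac ∈ A.wt 0 := by
  rw [A.wt_zero]; exact Submodule.mem_span_singleton_self _

lemma L_zero_apply {k : ℕ} {v : V} (hv : v ∈ A.wt k) : A.L 0 v = (k : ℂ) • v := A.L_zero k v hv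

lemma L_neg_two_vac : A.L (-2) A.vac = A.conf := A.mode_neg_one_vac A.conf

lemma L_neg_mem {k : ℕ} {v : V} (hv : v ∈ A.wt k) (m : ℕ) : A.L (-m) v ∈ A.wt (m + k) :=
  A.mode_mem_wt A.conf_mem hv (by push_cast; ring)

variable {A}

lemma primary_mem_wt {k : ℕ} {b : V} (hb : b ∈ A.primary k) : b ∈ A.wt k := hb.1

lemma L_primary {k : ℕ} {b : V} (hb : b ∈ A.primary k) {n : ℤ} (hn : 0 < n) : A.L n b = 0 := by
  have := (Submodule.mem_iInf _).mp hb.2 ⟨n, hn⟩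
  exact this

/-- `[L_m, b_n] = (m - n + 1) b_{m+n}` for `b` primary of weight two. -/
lemma L_mode_primary {b : V} (hb : b ∈ A.primary 2) (m n : ℤ) (v : V) :
    A.L m (A.mode b n v) = A.mode b n (A.L m v) +
      ((m - n + 1 : ℤ) : ℂ) • A.mode b (m + n) v := by
  have h := A.mode_bracket_mode A.conf b 2 (fun j hj => ?_) (m + 1) n
  · have h0 : A.mode (A.mode A.conf 0 b) (m + 1 + n) =
        (-(m + 1 + n : ℤ) : ℂ) • A.mode b (m + 1 + n - 1) := A.mode_L_neg_one b (m + 1 + n)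
    have h1 : A.mode A.conf 1 b = ((2 : ℕ) : ℂ) • b := A.L_zero 2 b (primary_mem_wt hb)
    have e : m + 1 + n - 1 = m + n := by ring
    simp only [Finset.sum_range_succ, Finset.sum_range_zero, zero_add, Nat.cast_zero,
      Ring.choose_zero_right, one_smul, sub_zero, Nat.cast_one, Ring.choose_one_right, h0, h1,
      mode_smul, e] at h
    replace h := congrArg (fun f => f v) h
    simp only [Ring.lie_def, LinearMap.sub_apply, Module.End.mul_apply, LinearMap.add_apply,
      LinearMap.smul_apply] at h
    change A.mode A.conf (m + 1) (A.mode b n v) = A.mode b n (A.mode A.conf (m + 1) v) + _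
    rw [← sub_eq_iff_eq_add', h]
    push_cast
    module
  · have := L_primary hb (show (0 : ℤ) < j - 1 by omega)
    rwa [L, sub_add_cancel] at this

/-! ### The metric -/

variable {B : LinearMap.BilinForm ℂ V}

lemma IsLiZMetric.mode_adjoint (hB : A.IsLiZMetric B) {k : ℕ} {x : V} (hx : x ∈ A.wt k)
    (hL : A.L 1 x = 0) (m : ℤ) (a b : V) :
    (-1 : ℂ) ^ k * B (A.mode x (2 * k - m - 2) a) b = B a (A.mode x m b) := by
  rw [← hB.invariant k x hx m a b, Finset.sum_range_succ', Finset.sum_eq_zero]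
  · simp
  · intro i _
    rw [pow_succ, Module.End.mul_apply, hL]
    simp

lemma L_one_conf (hV1 : A.wt 1 = ⊥) : A.L 1 A.conf = 0 := by
  have : A.L 1 A.conf ∈ A.wt 1 := A.mode_mem_wt A.conf_mem A.conf_mem (by norm_num)
  rwa [hV1, Submodule.mem_bot] at this

/-- As `V_1 = 0` forces `L_1 ω = 0`, the exponential in the invariance identity reduces to its
constant term. -/
lemma IsLiZMetric.L_adjoint (hB : A.IsLiZMetric B) (hV1 : A.wt 1 = ⊥) (m : ℤ) (a b : V) :
    B (A.L m a) b = B a (A.L (-m) b) := by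
  have := hB.mode_adjoint A.conf_mem (L_one_conf hV1) (-m + 1) a b
  rw [L, L, ← this]
  norm_num
  congr 4
  ring

/-- Moving `L_{-m}` to the left of `b_n` leaves only the commutator, since its adjoint `L_m` kills
the primary vector `a`. -/
lemma IsLiZMetric.apply_mode_L_neg (hB : A.IsLiZMetric B) (hV1 : A.wt 1 = ⊥) {a b : V}
    (ha : a ∈ A.primary 2) (hb : b ∈ A.primary 2) {m : ℤ} (hm : 0 < m) (n : ℤ) (v : V) :
    B a (A.mode b n (A.L (-m) v)) = ((m + n - 1 : ℤ) : ℂ) * B a (A.mode b (n - m) v) := by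
  have h := congrArg (B a) (L_mode_primary hb (-m) n v)
  rw [← hB.L_adjoint hV1, L_primary ha hm, map_zero, LinearMap.zero_apply, map_add, map_smul,
    smul_eq_mul, neg_add_eq_sub] at h
  rw [eq_neg_of_add_eq_zero_left h.symm]
  push_cast
  ring

/-! ### Products of vectors of weight two -/

lemma mode_three {x y : V} (hB : A.IsLiZMetric B) (hx : x ∈ A.primary 2) (hy : y ∈ A.wt 2) :
    A.mode x 3 y = B x y • A.vac := by
  have h : A.mode x 3 y ∈ A.wt 0 := A.mode_mem_wt (primary_mem_wt hx) hy (by norm_num)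
  rw [A.wt_zero] at h
  obtain ⟨r, hr⟩ := Submodule.mem_span_singleton.mp h
  have h2 := hB.mode_adjoint (primary_mem_wt hx) (L_primary hx one_pos) 3 A.vac y
  have hv : A.mode x (-1) A.vac = x := A.mode_neg_one_vac x
  norm_num at h2
  rw [hv, ← hr, map_smul, hB.vac_vac] at h2
  rw [← hr, h2]
  simp

lemma mode_two (hV1 : A.wt 1 = ⊥) {x y : V} (hx : x ∈ A.wt 2) (hy : y ∈ A.wt 2) :
    A.mode x 2 y = 0 := by
  have : A.mode x 2 y ∈ A.wt 1 := A.mode_mem_wt hx hy (by norm_num)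
  rwa [hV1, Submodule.mem_bot] at this

/-- The commutator formula for vectors of weight two. -/
lemma mode_mode_of_wt_two (hV1 : A.wt 1 = ⊥) {x y : V} (hx : x ∈ A.wt 2) (hy : y ∈ A.wt 2)
    (m n : ℤ) (v : V) :
    A.mode x m (A.mode y n v) = A.mode y n (A.mode x m v) + (A.mode (A.mode x 0 y) (m + n) v +
      m • A.mode (A.mode x 1 y) (m + n - 1) v +
        Ring.choose m 3 • A.mode (A.mode x 3 y) (m + n - 3) v) := by
  have h := A.mode_bracket_mode x y 4 (fun j hj => A.mode_eq_zero hx hy (by push_cast; omega)) m n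
  replace h := congrArg (fun f => f v) h
  simp only [Finset.sum_range_succ, Finset.sum_range_zero, Ring.lie_def, LinearMap.sub_apply,
    Module.End.mul_apply, LinearMap.add_apply, LinearMap.smul_apply] at h
  rw [← sub_eq_iff_eq_add', h]
  simp [mode_two hV1 hx hy]

/-- The product `x_1 y` on `V_2` is commutative if `V_1 = 0`. -/
lemma mode_one_comm (hV1 : A.wt 1 = ⊥) {x y : V} (hx : x ∈ A.wt 2) (hy : y ∈ A.wt 2) :
    A.mode x 1 y = A.mode y 1 x := by
  have hn1 : ∀ x : V, A.mode x (-1) A.vac = x := A.mode_neg_one_vac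
  have hnn : ∀ (x : V) (k : ℤ), 0 ≤ k → A.mode x k A.vac = 0 := A.mode_nonneg_vac
  -- On the vacuum, `[x_{-1}, y_1]` reduces to `0 = y_1 x - x_1 y`: the other terms contain
  -- nonnegative modes on `𝟏` or the mode `𝟏_{-3} = 0`.
  have h := mode_mode_of_wt_two hV1 hx hy (-1) 1 A.vac
  have h3 : A.mode x 3 y ∈ A.wt 0 := A.mode_mem_wt hx hy (by norm_num)
  rw [A.wt_zero] at h3
  obtain ⟨r, hr⟩ := Submodule.mem_span_singleton.mp h3
  have hv : A.mode A.vac (-3) = 0 := by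
    have := A.mode_vac (-3)
    rwa [if_neg (by norm_num)] at this
  rw [← hr, mode_smul, hnn y 1 (by norm_num), hn1] at h
  norm_num [hn1, hnn, hv] at h
  rw [eq_comm, add_neg_eq_zero] at h
  exact h.symm

end VertexOperatorAlgebra

namespace VertexOperatorAlgebra

variable {V : Type*} [AddCommGroup V] [Module ℂ V] {A : VertexOperatorAlgebra V}
  {B : LinearMap.BilinForm ℂ V}

/-! ### Quadratic Casimir vectors -/

section Casimir

variable {ι : Type*} [Fintype ι] {u u' : Module.Basis ι ℂ (A.primary 2)}

/-- Each `u_α` is killed by `L_m`, so only the commutator `[L_m, u^α_{3-n}]` remains. -/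
lemma L_casimir {m : ℤ} (hm : 0 < m) (n : ℤ) :
    A.L m (A.casimir u u' n) = ((m + n - 2 : ℤ) : ℂ) • A.casimir u u' (n - m) := by
  simp only [casimir, map_sum, Finset.smul_sum]
  refine Finset.sum_congr rfl fun α _ => ?_
  rw [L_mode_primary (u' α).2, L_primary (u α).2 hm, map_zero, zero_add,
    show m + (3 - n) = 3 - (n - m) by ring, show m - (3 - n) + 1 = m + n - 2 by ring]

variable [DecidableEq ι]

lemma sum_dual_smul (hB : A.IsLiZMetric B)
    (hdual : ∀ α β, B (u' α : V) (u β : V) = if α = β then 1 else 0) (b : A.primary 2) :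
    ∑ α, B (b : V) (u' α : V) • u α = b := by
  have h : ∀ α, B (b : V) (u' α : V) = u.repr b α := by
    intro α
    rw [hB.symm.eq]
    have hb : (b : V) = ∑ γ, u.repr b γ • (u γ : V) := by
      conv_lhs => rw [← u.sum_repr b]
      simp only [Submodule.coe_sum, Submodule.coe_smul]
    rw [hb]
    simp [hdual]
  simp only [h]
  exact u.sum_repr b

/-- The Casimir tensor `∑ u^α ⊗ u_α` is symmetric. -/
lemma sum_dual_symm (hB : A.IsLiZMetric B)
    (hdual : ∀ α β, B (u' α : V) (u β : V) = if α = β then 1 else 0)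
    {W : Type*} [AddCommGroup W] [Module ℂ W] (β : V →ₗ[ℂ] V →ₗ[ℂ] W) :
    ∑ α, β (u' α : V) (u α : V) = ∑ α, β (u α : V) (u' α : V) := by
  have h : ∀ α, (u' α : V) = ∑ γ, B (u' α : V) (u' γ : V) • (u γ : V) := by
    intro α
    conv_lhs => rw [← sum_dual_smul hB hdual (u' α)]
    simp
  calc ∑ α, β (u' α : V) (u α : V)
      = ∑ α, ∑ γ, B (u' α : V) (u' γ : V) • β (u γ : V) (u α : V) := by
        refine Finset.sum_congr rfl fun α _ => ?_
        conv_lhs => rw [h α]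
        simp
    _ = ∑ γ, ∑ α, B (u' γ : V) (u' α : V) • β (u γ : V) (u α : V) := by
        rw [Finset.sum_comm]
        refine Finset.sum_congr rfl fun γ _ => Finset.sum_congr rfl fun α _ => ?_
        rw [hB.symm.eq]
    _ = ∑ α, β (u α : V) (u' α : V) := by
        refine Finset.sum_congr rfl fun α _ => ?_
        conv_rhs => rw [h α]
        simp

lemma casimir_zero (hB : A.IsLiZMetric B)
    (hdual : ∀ α β, B (u' α : V) (u β : V) = if α = β then 1 else 0) :
    A.casimir u u' 0 = (Module.finrank ℂ (A.primary 2) : ℂ) • A.vac := by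
  simp [casimir, mode_three hB (u' _).2 (primary_mem_wt (u _).2), hdual,
    Module.finrank_eq_card_basis u, Nat.cast_smul_eq_nsmul]

/-- The relation between the actions of the Casimir vectors of weights `2`, `4` and `6`. -/
lemma mode_casimir (hB : A.IsLiZMetric B) (hV1 : A.wt 1 = ⊥)
    (hdual : ∀ α β, B (u' α : V) (u β : V) = if α = β then 1 else 0) {b : V}
    (hb : b ∈ A.primary 2) :
    A.mode b 5 (A.casimir u u' 6) - (3 : ℂ) • A.mode b 3 (A.casimir u u' 4) +
      (2 : ℂ) • A.mode b 1 (A.casimir u u' 2) = (4 : ℂ) • b := by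
  have hn1 : ∀ x : V, A.mode x (-1) A.vac = x := A.mode_neg_one_vac
  have hbw := primary_mem_wt hb
  have hu : ∀ α, (u α : V) ∈ A.wt 2 := fun α => primary_mem_wt (u α).2
  have hu' : ∀ α, (u' α : V) ∈ A.wt 2 := fun α => primary_mem_wt (u' α).2
  have hvm : A.mode A.vac (-1) = 1 := by
    have := A.mode_vac (-1)
    rwa [if_pos rfl] at this
  have c3 : Ring.choose (3 : ℤ) 3 = 1 := by
    have := Ring.choose_natCast (R := ℤ) 3 3
    simpa using this
  have c5 : Ring.choose (5 : ℤ) 3 = 10 := by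
    have := Ring.choose_natCast (R := ℤ) 5 3
    simpa [Nat.choose] using this
  have c1 : Ring.choose (1 : ℤ) 3 = 0 := by
    have := Ring.choose_natCast (R := ℤ) 1 3
    simpa [Nat.choose] using this
  -- After summation, the three expansions involve only two unknown vectors, `∑ (b_0 u^α)_2 u_α` and
  -- `∑ (b_1 u^α)_1 u_α`, with coefficients `(1,5)`, `(1,3)` and, by `s1`, `(1,2)`. The weights `1,
  -- -3, 2` cancel both and leave `10b - 6b`.
  have h5 : ∀ α, A.mode b 5 (A.mode (u' α) (-3) (u α)) =
      A.mode (A.mode b 0 (u' α)) 2 (u α) + (5 : ℂ) • A.mode (A.mode b 1 (u' α)) 1 (u α) +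
        (10 * B b (u' α)) • (u α : V) := by
    intro α
    rw [mode_mode_of_wt_two hV1 hbw (hu' α), A.mode_eq_zero hbw (hu α) (by norm_num),
      mode_three hB hb (hu' α), mode_smul, c5]
    norm_num [hvm]
    module
  have h3 : ∀ α, A.mode b 3 (A.mode (u' α) (-1) (u α)) =
      A.mode (A.mode b 0 (u' α)) 2 (u α) + (3 : ℂ) • A.mode (A.mode b 1 (u' α)) 1 (u α) +
        B b (u' α) • (u α : V) + B b (u α) • (u' α : V) := by
    intro α
    rw [mode_mode_of_wt_two hV1 hbw (hu' α), mode_three hB hb (hu α),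
      mode_three hB hb (hu' α), mode_smul, c3]
    norm_num [hvm, hn1]
    module
  have h1 : ∀ α, A.mode b 1 (A.mode (u' α) 1 (u α)) =
      A.mode (A.mode b 0 (u' α)) 2 (u α) + A.mode (A.mode b 1 (u' α)) 1 (u α) +
        A.mode (u' α) 1 (A.mode b 1 (u α)) := by
    intro α
    rw [mode_mode_of_wt_two hV1 hbw (hu' α), c1]
    norm_num
    abel
  have s1 : ∑ α, A.mode (A.mode b 1 (u' α)) 1 (u α) = ∑ α, A.mode (u' α) 1 (A.mode b 1 (u α)) := by
    refine Eq.trans ?_ (sum_dual_symm hB hdual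
      (LinearMap.compl₂ (A.modeₗ 1 : V →ₗ[ℂ] V →ₗ[ℂ] V) (A.mode b 1))).symm
    refine Finset.sum_congr rfl fun α _ => ?_
    exact mode_one_comm hV1 (A.mode_mem_wt hbw (hu' α) (by norm_num)) (hu α)
  have s2 : ∑ α, B b (u' α) • (u α : V) = b := by
    have := congrArg Subtype.val (sum_dual_smul hB hdual ⟨b, hb⟩)
    simpa using this
  have s3 : ∑ α, B b (u α) • (u' α : V) = b := by
    refine Eq.trans ?_ s2
    exact (sum_dual_symm hB hdual (LinearMap.lsmul ℂ V ∘ₗ B b)).symm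
  simp only [casimir, map_sum]
  norm_num only
  simp only [h5, h3, h1, Finset.sum_add_distrib, ← Finset.smul_sum, mul_smul, s1, s2, s3]
  module

end Casimir

/-! ### Virasoro descendants of the vacuum -/

variable (A) in
/-- A spanning set of the Virasoro descendants of the vacuum of weight `n ≤ 6`. -/
noncomputable def descendantSet : ℕ → Set V
  | 0 => {A.vac}
  | 2 => {A.L (-2) A.vac}
  | 3 => {A.L (-3) A.vac}
  | 4 => {A.L (-4) A.vac, A.L (-2) (A.L (-2) A.vac)}
  | 5 => {A.L (-5) A.vac, A.L (-3) (A.L (-2) A.vac)}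
  | 6 => {A.L (-6) A.vac, A.L (-4) (A.L (-2) A.vac), A.L (-3) (A.L (-3) A.vac),
      A.L (-2) (A.L (-2) (A.L (-2) A.vac))}
  | _ => ∅

/-- `L_{-1}` is commuted through to the vacuum, which it kills; the only other products out of order
are `L_{-2} L_{-3}` and `L_{-2} L_{-4}`. -/
lemma L_neg_mem_span_descendantSet {m s : ℕ} (hm : 1 ≤ m) (hs : m + s ≤ 6) {w : V}
    (hw : w ∈ Submodule.span ℂ (A.descendantSet s)) :
    A.L (-m) w ∈ Submodule.span ℂ (A.descendantSet (m + s)) := by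
  have v1 : A.L (-1) A.vac = 0 := A.L_vac le_rfl
  have hb : ∀ n : ℤ, ∀ v : V, n < 0 → A.L (-1) (A.L n v) = A.L n (A.L (-1) v) +
      ((-1 - n : ℤ) : ℂ) • A.L (-1 + n) v := by
    intro n v hn
    rw [L_L_apply, if_neg (by omega), zero_smul, add_zero]
  have e23 : A.L (-2) (A.L (-3) A.vac) = A.L (-3) (A.L (-2) A.vac) + A.L (-5) A.vac := by
    rw [L_L_apply]; norm_num
  have e24 : A.L (-2) (A.L (-4) A.vac) =
      A.L (-4) (A.L (-2) A.vac) + (2 : ℂ) • A.L (-6) A.vac := by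
    rw [L_L_apply]; norm_num
  suffices h : Submodule.span ℂ (A.descendantSet s) ≤
      (Submodule.span ℂ (A.descendantSet (m + s))).comap (A.L (-m)) from h hw
  rw [Submodule.span_le]
  intro x hx
  change A.L (-m) x ∈ Submodule.span ℂ (A.descendantSet (m + s))
  have hms : s ≤ 6 - m := by omega
  have hm6 : m ≤ 6 := by omega
  interval_cases m <;> interval_cases s <;>
    simp only [descendantSet, Set.mem_insert_iff, Set.mem_singleton_iff, Set.mem_empty_iff_false]
      at hx <;>
    rcases hx with rfl | rfl | rfl | rfl
  all_goals
    simp only [Nat.cast_one, Nat.cast_ofNat, Nat.reduceAdd, descendantSet]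
    first
    | apply Submodule.subset_span; simp; done
    | norm_num [hb, v1, e23, e24]
      repeat' first
        | apply Submodule.add_mem
        | apply Submodule.smul_mem
        | apply Submodule.subset_span; simp

lemma vacuumDescendants_six_le :
    A.vacuumDescendants 6 ≤ Submodule.span ℂ (A.descendantSet 6) := by
  have key : ∀ l : List ℕ, (∀ m ∈ l, 1 ≤ m) → l.sum ≤ 6 →
      l.foldr (fun m w => A.L (-(m : ℤ)) w) A.vac ∈ Submodule.span ℂ (A.descendantSet l.sum) := by
    intro l
    induction l with
    | nil => intro _ _; exact Submodule.subset_span rfl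
    | cons m l ih =>
      intro h hs
      rw [List.sum_cons] at hs ⊢
      exact L_neg_mem_span_descendantSet (h m (by simp)) hs
        (ih (fun k hk => h k (by simp [hk])) (by omega))
  rw [vacuumDescendants, Submodule.span_le]
  rintro v ⟨l, h1, h2, rfl⟩
  rw [← h2]
  exact key l h1 h2.le

end VertexOperatorAlgebra

namespace VertexOperatorAlgebra

variable {V : Type*} [AddCommGroup V] [Module ℂ V] {A : VertexOperatorAlgebra V}
  {B : LinearMap.BilinForm ℂ V}

/-! ### Positive Virasoro modes on the descendants of weight at most six -/

section Virasoro

/-- The commutation relation of `L_m` and `L_{-n}` for `m ≠ n`. -/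
lemma L_L_apply_of_ne {m n : ℤ} (h : m + n ≠ 0) (v : V) :
    A.L m (A.L n v) = A.L n (A.L m v) + ((m - n : ℤ) : ℂ) • A.L (m + n) v := by
  rw [L_L_apply, if_neg h, zero_smul, add_zero]

lemma L_L_neg_apply {k : ℕ} {v : V} (hv : v ∈ A.wt k) (m : ℤ) :
    A.L m (A.L (-m) v) = A.L (-m) (A.L m v) +
      (2 * m * k + ((m ^ 3 - m : ℤ) : ℂ) / 12 * A.c) • v := by
  rw [L_L_apply, if_pos (by ring), add_neg_cancel, L_zero_apply A hv]
  push_cast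
  module

lemma L_pos_of_wt {k : ℕ} {v : V} (hv : v ∈ A.wt k) {m : ℤ} (hm : (k : ℤ) < m) : A.L m v = 0 :=
  A.mode_eq_zero A.conf_mem hv (by push_cast; omega)

lemma L_neg_one_vac : A.L (-1) A.vac = 0 := A.L_vac le_rfl

lemma L_one_L_neg_two : A.L 1 (A.L (-2) A.vac) = 0 := by
  rw [L_L_apply_of_ne (by norm_num), L_vac A (by norm_num)]
  norm_num [L_neg_one_vac]

lemma L_two_L_neg_two : A.L 2 (A.L (-2) A.vac) = (A.c / 2) • A.vac := by
  rw [L_L_neg_apply A.vac_mem, L_vac A (by norm_num), map_zero, zero_add]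
  congr 1
  norm_num
  ring

lemma L_two_L_neg_four : A.L 2 (A.L (-4) A.vac) = (6 : ℂ) • A.L (-2) A.vac := by
  rw [L_L_apply_of_ne (by norm_num), L_vac A (by norm_num)]
  norm_num

lemma neg_two_vac_mem : A.L (-2) A.vac ∈ A.wt 2 := by
  rw [L_neg_two_vac]; exact A.conf_mem

lemma neg_two_neg_two_vac_mem : A.L (-2) (A.L (-2) A.vac) ∈ A.wt 4 :=
  A.L_neg_mem neg_two_vac_mem 2

lemma L_neg_three_vac_mem : A.L (-3) A.vac ∈ A.wt 3 := A.L_neg_mem A.vac_mem 3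

lemma L_two_L_neg_two_sq :
    A.L 2 (A.L (-2) (A.L (-2) A.vac)) = (A.c + 8) • A.L (-2) A.vac := by
  rw [L_L_neg_apply neg_two_vac_mem, L_two_L_neg_two, map_smul]
  norm_num
  module

lemma L_two_L_neg_six : A.L 2 (A.L (-6) A.vac) = (8 : ℂ) • A.L (-4) A.vac := by
  rw [L_L_apply_of_ne (by norm_num), L_vac A (by norm_num)]
  norm_num

lemma L_two_L_neg_four_L_neg_two : A.L 2 (A.L (-4) (A.L (-2) A.vac)) =
    (A.c / 2) • A.L (-4) A.vac + (6 : ℂ) • A.L (-2) (A.L (-2) A.vac) := by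
  rw [L_L_apply_of_ne (by norm_num), L_two_L_neg_two, map_smul]
  norm_num

lemma L_two_L_neg_three : A.L 2 (A.L (-3) A.vac) = 0 := by
  rw [L_L_apply_of_ne (by norm_num), L_vac A (by norm_num)]
  norm_num [L_neg_one_vac]

lemma L_two_L_neg_three_sq : A.L 2 (A.L (-3) (A.L (-3) A.vac)) = (10 : ℂ) • A.L (-4) A.vac := by
  rw [L_L_apply_of_ne (by norm_num), L_two_L_neg_three, map_zero, zero_add]
  norm_num
  rw [L_L_apply_of_ne (by norm_num), L_neg_one_vac]
  norm_num
  module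

lemma L_two_L_neg_two_cube : A.L 2 (A.L (-2) (A.L (-2) (A.L (-2) A.vac))) =
    (3 / 2 * A.c + 24) • A.L (-2) (A.L (-2) A.vac) := by
  rw [L_L_neg_apply neg_two_neg_two_vac_mem, L_two_L_neg_two_sq, map_smul]
  norm_num
  module

lemma L_three_L_neg_two : A.L 3 (A.L (-2) A.vac) = 0 :=
  L_pos_of_wt neg_two_vac_mem (by norm_num)

lemma L_four_L_neg_two : A.L 4 (A.L (-2) A.vac) = 0 :=
  L_pos_of_wt neg_two_vac_mem (by norm_num)

lemma L_three_L_neg_three : A.L 3 (A.L (-3) A.vac) = (2 * A.c) • A.vac := by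
  rw [L_L_neg_apply A.vac_mem, L_vac A (by norm_num), map_zero, zero_add]
  congr 1
  norm_num

lemma L_four_L_neg_four : A.L 4 (A.L (-4) A.vac) = (5 * A.c) • A.vac := by
  rw [L_L_neg_apply A.vac_mem, L_vac A (by norm_num), map_zero, zero_add]
  congr 1
  norm_num

lemma L_four_L_neg_two_sq : A.L 4 (A.L (-2) (A.L (-2) A.vac)) = (3 * A.c) • A.vac := by
  rw [L_L_apply_of_ne (by norm_num), L_four_L_neg_two, map_zero, zero_add]
  norm_num [L_two_L_neg_two]
  module

lemma L_three_L_neg_six : A.L 3 (A.L (-6) A.vac) = (9 : ℂ) • A.L (-3) A.vac := by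
  rw [L_L_apply_of_ne (by norm_num), L_vac A (by norm_num)]
  norm_num

lemma L_three_L_neg_four_L_neg_two :
    A.L 3 (A.L (-4) (A.L (-2) A.vac)) = (7 : ℂ) • A.L (-3) A.vac := by
  rw [L_L_apply_of_ne (by norm_num), L_three_L_neg_two, map_zero, zero_add]
  norm_num
  rw [L_L_apply_of_ne (by norm_num), L_neg_one_vac]
  norm_num

lemma L_three_L_neg_three_sq :
    A.L 3 (A.L (-3) (A.L (-3) A.vac)) = (4 * A.c + 18) • A.L (-3) A.vac := by
  rw [L_L_neg_apply L_neg_three_vac_mem, L_three_L_neg_three, map_smul]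
  norm_num
  module

lemma L_one_L_neg_two_sq :
    A.L 1 (A.L (-2) (A.L (-2) A.vac)) = (3 : ℂ) • A.L (-3) A.vac := by
  rw [L_L_apply_of_ne (by norm_num), L_one_L_neg_two, map_zero, zero_add]
  norm_num
  rw [L_L_apply_of_ne (by norm_num), L_neg_one_vac]
  norm_num

lemma L_three_L_neg_two_cube :
    A.L 3 (A.L (-2) (A.L (-2) (A.L (-2) A.vac))) = (15 : ℂ) • A.L (-3) A.vac := by
  rw [L_L_apply_of_ne (by norm_num), L_L_apply_of_ne (by norm_num) (A.L (-2) A.vac),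
    L_three_L_neg_two]
  norm_num [L_one_L_neg_two, L_one_L_neg_two_sq]
  module

lemma L_six_L_neg_six : A.L 6 (A.L (-6) A.vac) = (35 / 2 * A.c) • A.vac := by
  rw [L_L_neg_apply A.vac_mem, L_vac A (by norm_num), map_zero, zero_add]
  congr 1
  norm_num

lemma L_six_L_neg_four_L_neg_two :
    A.L 6 (A.L (-4) (A.L (-2) A.vac)) = (5 * A.c) • A.vac := by
  rw [L_L_apply_of_ne (by norm_num), L_pos_of_wt neg_two_vac_mem (by norm_num), map_zero, zero_add]
  norm_num [L_two_L_neg_two]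
  module

lemma L_six_L_neg_three_sq :
    A.L 6 (A.L (-3) (A.L (-3) A.vac)) = (18 * A.c) • A.vac := by
  rw [L_L_apply_of_ne (by norm_num), L_pos_of_wt L_neg_three_vac_mem (by norm_num), map_zero,
    zero_add]
  norm_num [L_three_L_neg_three]
  module

lemma L_six_L_neg_two_cube :
    A.L 6 (A.L (-2) (A.L (-2) (A.L (-2) A.vac))) = (24 * A.c) • A.vac := by
  rw [L_L_apply_of_ne (by norm_num), L_pos_of_wt neg_two_neg_two_vac_mem (by norm_num), map_zero,
    zero_add]
  norm_num [L_four_L_neg_two_sq]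
  module

end Virasoro

/-! ### Pairings of `b_n` applied to vacuum descendants, and the resulting linear system. -/

section

variable {a b : V}

lemma IsLiZMetric.apply_mode_L_neg_vac (hB : A.IsLiZMetric B) (hV1 : A.wt 1 = ⊥)
    (ha : a ∈ A.primary 2) (hb : b ∈ A.primary 2) {m : ℤ} (hm : 0 < m) :
    B a (A.mode b (m - 1) (A.L (-m) A.vac)) = (2 * m - 2) * B a b := by
  have hv : A.mode b (-1) A.vac = b := A.mode_neg_one_vac b
  rw [hB.apply_mode_L_neg hV1 ha hb hm, show m - 1 - m = -1 by ring, hv]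
  push_cast
  ring

lemma IsLiZMetric.apply_mode_L_neg_L_neg_vac (hB : A.IsLiZMetric B) (hV1 : A.wt 1 = ⊥)
    (ha : a ∈ A.primary 2) (hb : b ∈ A.primary 2) {m n : ℤ} (hm : 0 < m) (hn : 0 < n) :
    B a (A.mode b (m + n - 1) (A.L (-m) (A.L (-n) A.vac))) =
      (2 * m + n - 2) * (2 * n - 2) * B a b := by
  rw [hB.apply_mode_L_neg hV1 ha hb hm, show m + n - 1 - m = n - 1 by ring,
    hB.apply_mode_L_neg_vac hV1 ha hb hn]
  push_cast
  ring

end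

/-- The linear system for the coefficients of the Casimir vectors determines `p`. -/
lemma eq_of_casimir_system {c p x₁ x₂ x₃ x₄ y₁ y₂ z : ℂ} (hc : c ≠ 0) (hD : 5 * c + 22 ≠ 0)
    (hy₁ : 6 * y₁ = 8 * x₁ + c / 2 * x₂ + 10 * x₃) (hy₂ : 6 * y₂ = 6 * x₂ + (3 / 2 * c + 24) * x₄)
    (hz : 4 * z = 6 * y₁ + (c + 8) * y₂) (h2 : c / 2 * z = 2 * p)
    (h4 : 5 * c * y₁ + 3 * c * y₂ = 6 * p)
    (h3 : 2 * c * (9 * x₁ + 7 * x₂ + (4 * c + 18) * x₃ + 15 * x₄) = 28 * p)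
    (h6 : 35 / 2 * c * x₁ + 5 * c * x₂ + 18 * c * x₃ + 24 * c * x₄ = 10 * p)
    (h : (10 * x₁ + 16 * x₂ + 28 * x₃ + 48 * x₄) - 3 * (6 * y₁ + 8 * y₂) + 2 * (2 * z) = 4) :
    2 * p * (c ^ 2 - 55 * c + 748) = (5 * c + 22) * (2 * c - 1) * (7 * c + 68) := by
  -- This scaling of `p` makes `z`, `y₁`, `y₂` polynomial in `c` and `r`.
  obtain ⟨r, rfl⟩ : ∃ r, p = c * (5 * c + 22) * r := ⟨p / (c * (5 * c + 22)), (mul_div_cancel₀ p (mul_ne_zero hc hD)).symm⟩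
  have hz' : z = 4 * (5 * c + 22) * r := mul_left_cancel₀ hc (by linear_combination 2 * h2)
  subst hz'
  have h4' : 5 * y₁ + 3 * y₂ = 6 * (5 * c + 22) * r :=
    mul_left_cancel₀ hc (by linear_combination h4)
  have hy₂' : y₂ = 44 * r :=
    mul_left_cancel₀ hD (by linear_combination -5 * hz - 6 * h4')
  subst hy₂'
  have hy₁' : y₁ = 6 * c * r := by linear_combination 1 / 5 * h4'
  subst hy₁'
  have h3' : 9 * x₁ + 7 * x₂ + (4 * c + 18) * x₃ + 15 * x₄ = 14 * (5 * c + 22) * r :=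
    mul_left_cancel₀ hc (by linear_combination 1 / 2 * h3)
  have h6' : 35 / 2 * x₁ + 5 * x₂ + 18 * x₃ + 24 * x₄ = 10 * (5 * c + 22) * r :=
    mul_left_cancel₀ hc (by linear_combination h6)
  -- The equations `hy₁`, `hy₂`, `h3'`, `h6'` form a 4 × 4 system in the `xᵢ` with determinant `3/4
  -- (5c+22)(2c-1)(7c+68)`. Multiplying `h` by it and using cofactor combinations of the other rows
  -- eliminates the `xᵢ` without dividing by the determinant.
  linear_combination 1 / 3 * ((-4488 + 3930 * c + 342 * c ^ 2 - 30 * c ^ 3) * h6' +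
    (11220 - 8637 * c - 1380 * c ^ 2) * -hy₁ + (6732 - 6819 * c - 1200 * c ^ 2) * -hy₂ +
    (-2046 * c - 465 / 2 * c ^ 2) * h3' +
    3 / 4 * (5 * c + 22) * (2 * c - 1) * (7 * c + 68) * h)

end VertexOperatorAlgebra

/-! ### The dimension formula. -/

open VertexOperatorAlgebra in
theorem mainTheorem5 {V : Type*} [AddCommGroup V] [Module ℂ V] (A : VertexOperatorAlgebra V)
    (B : LinearMap.BilinForm ℂ V) (hB : A.IsLiZMetric B)
    (hV1 : A.wt 1 = ⊥) (hP2 : 0 < Module.finrank ℂ (A.primary 2))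
    {ι : Type*} [Fintype ι] [DecidableEq ι]
    (u u' : Module.Basis ι ℂ (A.primary 2))
    (hdual : ∀ α β, B (u' α : V) (u β : V) = if α = β then 1 else 0)
    (hC0 : A.c ≠ 0) (hC1 : A.c ≠ -22 / 5) (hC2 : A.c ≠ -68 / 7) (hC3 : A.c ≠ 1 / 2)
    (hcas : A.casimir u u' 6 ∈ A.vacuumDescendants 6) :
    A.c ^ 2 - 55 * A.c + 748 ≠ 0 ∧
      (Module.finrank ℂ (A.primary 2) : ℂ) =
        1 / 2 * ((5 * A.c + 22) * (2 * A.c - 1) * (7 * A.c + 68) /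
          (A.c ^ 2 - 55 * A.c + 748)) := by
  have hD1 : 5 * A.c + 22 ≠ 0 := fun h => hC1 (by linear_combination h / 5)
  have hD2 : 7 * A.c + 68 ≠ 0 := fun h => hC2 (by linear_combination h / 7)
  have hD3 : 2 * A.c - 1 ≠ 0 := fun h => hC3 (by linear_combination h / 2)
  suffices key : 2 * (Module.finrank ℂ (A.primary 2) : ℂ) * (A.c ^ 2 - 55 * A.c + 748) =
      (5 * A.c + 22) * (2 * A.c - 1) * (7 * A.c + 68) by
    have hQ : A.c ^ 2 - 55 * A.c + 748 ≠ 0 := by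
      intro h0
      -- A zero of the quadratic would make the product of the three factors vanish, which the
      -- excluded central charges prevent.
      rw [h0, mul_zero] at key
      exact mul_ne_zero (mul_ne_zero hD1 hD3) hD2 key.symm
    refine ⟨hQ, ?_⟩
    rw [← key, mul_div_cancel_right₀ _ hQ]
    ring
  obtain ⟨i⟩ : Nonempty ι := by
    rw [Module.finrank_eq_card_basis u] at hP2
    exact Fintype.card_pos_iff.mp hP2
  have ha := (u' i).2
  have hb := (u i).2
  have hab : B (u' i : V) (u i : V) = 1 := by rw [hdual, if_pos rfl]
  set a : V := ((u' i : A.primary 2) : V)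
  set b : V := ((u i : A.primary 2) : V)
  set p : ℂ := ((Module.finrank ℂ (A.primary 2) : ℕ) : ℂ)
  have h0 : A.casimir u u' 0 = p • A.vac := casimir_zero hB hdual
  have hsmul : ∀ {r s : ℂ}, r • A.vac = s • A.vac → r = s :=
    fun h => smul_left_injective ℂ A.vac_ne_zero h
  have hmem := vacuumDescendants_six_le hcas
  simp only [descendantSet, Submodule.mem_span_insert, Submodule.mem_span_singleton] at hmem
  obtain ⟨x₁, _, ⟨x₂, _, ⟨x₃, _, ⟨x₄, rfl⟩, rfl⟩, rfl⟩, h6⟩ := hmem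
  -- These coefficients are forced by `L_2 λ^(6) = 6 λ^(4)` and `L_2 λ^(4) = 4 λ^(2)`.
  set y₁ : ℂ := (8 * x₁ + A.c / 2 * x₂ + 10 * x₃) / 6 with hy₁
  set y₂ : ℂ := (6 * x₂ + (3 / 2 * A.c + 24) * x₄) / 6 with hy₂
  set z : ℂ := (6 * y₁ + (A.c + 8) * y₂) / 4 with hz
  have h4 : A.casimir u u' 4 =
      y₁ • A.L (-4) A.vac + y₂ • A.L (-2) (A.L (-2) A.vac) := by
    have := L_casimir (u := u) (u' := u') two_pos 6
    norm_num at this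
    rw [← inv_smul_eq_iff₀ (by norm_num)] at this
    rw [← this, h6]
    simp only [map_add, map_smul, L_two_L_neg_six, L_two_L_neg_four_L_neg_two,
      L_two_L_neg_three_sq, L_two_L_neg_two_cube, hy₁, hy₂]
    module
  have h2 : A.casimir u u' 2 = z • A.L (-2) A.vac := by
    have := L_casimir (u := u) (u' := u') two_pos 4
    norm_num at this
    rw [← inv_smul_eq_iff₀ (by norm_num)] at this
    rw [← this, h4]
    simp only [map_add, map_smul, L_two_L_neg_four, L_two_L_neg_two_sq, hz]
    module
  have h3 : A.casimir u u' 3 = (7 : ℂ)⁻¹ •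
      ((9 * x₁ + 7 * x₂ + (4 * A.c + 18) * x₃ + 15 * x₄) • A.L (-3) A.vac) := by
    have := L_casimir (u := u) (u' := u') three_pos 6
    norm_num at this
    rw [← inv_smul_eq_iff₀ (by norm_num)] at this
    rw [← this, h6]
    simp only [map_add, map_smul, L_three_L_neg_six, L_three_L_neg_four_L_neg_two,
      L_three_L_neg_three_sq, L_three_L_neg_two_cube]
    module
  refine eq_of_casimir_system (x₁ := x₁) (x₂ := x₂) (x₃ := x₃) (x₄ := x₄) (y₁ := y₁) (y₂ := y₂)
    (z := z) hC0 hD1 (by rw [hy₁]; ring) (by rw [hy₂]; ring) (by rw [hz]; ring) ?_ ?_ ?_ ?_ ?_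
  -- This and the next three goals compare vacuum coefficients in `L_m λ^(m) = (2m-2) p 𝟏`; the
  -- factor 7 for `m = 3` clears the one in `h3`.
  · have := L_casimir (u := u) (u' := u') two_pos 2
    norm_num [h2, L_two_L_neg_two, h0, smul_smul] at this
    linear_combination hsmul this
  · have := L_casimir (u := u) (u' := u') four_pos 4
    norm_num [h4, L_four_L_neg_four, L_four_L_neg_two_sq, h0, smul_smul, ← add_smul] at this
    linear_combination hsmul this
  · have := L_casimir (u := u) (u' := u') three_pos 3
    norm_num [h3, L_three_L_neg_three, h0, smul_smul, ← add_smul] at this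
    linear_combination 7 * hsmul this
  · have := L_casimir (u := u) (u' := u') (show (0 : ℤ) < 6 by norm_num) 6
    norm_num [h6, L_six_L_neg_six, L_six_L_neg_four_L_neg_two, L_six_L_neg_three_sq,
      L_six_L_neg_two_cube, h0, smul_smul, ← add_smul] at this
    linear_combination hsmul this
  -- Pairing with `a`, where `⟨a, b⟩ = 1`, turns the Casimir relation into a scalar equation: the
  -- descendants contribute `10, 16, 28, 48` in weight 6, `6, 8` in weight 4 and `2` in weight 2.
  · have key := congrArg (B a) (mode_casimir hB hV1 hdual hb)
    have l6 := hB.apply_mode_L_neg_vac hV1 ha hb (show (0 : ℤ) < 6 by norm_num)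
    have l4 := hB.apply_mode_L_neg_vac hV1 ha hb (show (0 : ℤ) < 4 by norm_num)
    have l2 := hB.apply_mode_L_neg_vac hV1 ha hb (show (0 : ℤ) < 2 by norm_num)
    have l42 := hB.apply_mode_L_neg_L_neg_vac hV1 ha hb
      (show (0 : ℤ) < 4 by norm_num) (show (0 : ℤ) < 2 by norm_num)
    have l33 := hB.apply_mode_L_neg_L_neg_vac hV1 ha hb
      (show (0 : ℤ) < 3 by norm_num) (show (0 : ℤ) < 3 by norm_num)
    have l22 := hB.apply_mode_L_neg_L_neg_vac hV1 ha hb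
      (show (0 : ℤ) < 2 by norm_num) (show (0 : ℤ) < 2 by norm_num)
    have l222 := hB.apply_mode_L_neg hV1 ha hb (show (0 : ℤ) < 2 by norm_num) 5
      (A.L (-2) (A.L (-2) A.vac))
    norm_num [hab] at l6 l4 l2 l42 l33 l22 l222
    rw [l22] at l222
    rw [h6, h4, h2] at key
    simp only [map_add, map_sub, map_smul, smul_eq_mul, l6, l4, l2, l42, l33, l22, l222, hab]
      at key
    linear_combination key
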